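/- Let $H$ be a finite simple bipartite graph with a fixed ordered bipartition $A\cup B$, every edge being written as an ordered pair $(u,v)$ with $u\in A$, $v\in B$. For a $2$-edge-colouring $\alpha:E(H)\to\{0,1\}$ and a bounded measurable function $f:[0,1]^2\to\mathbb{C}$ put $$t_{H,\alpha}(f)=\int_{[0,1]^{A\cup B}}\ \prod_{e=(u,v)\in E(H)} f(x_u,y_v)^{\alpha(e)}\,\overline{f(x_u,y_v)}^{\,1-\alpha(e)}\ \prod_{u\in A}dx_u\prod_{v\in B}dy_v,\qquad \|f\|_{H,\alpha}=|t_{H,\alpha}(f)|^{1/\mathrm{e}(H)},$$ where $\mathrm{e}(H)=|E(H)|$ and $z^0=1$ for every $z\in\mathbb{C}$. Call $(H,\alpha)$ complex-norming if $\|\cdot\|_{H,\alpha}$ is a norm on the complex vector space of bounded measurable functions $[0,1]^2\to\mathbb{C}$ (functions equal almost everywhere being identified), and call $H$ complex-norming if $(H,\alpha)$ is complex-norming for some $2$-edge-colouring $\alpha$ of $H$. If $H$ is complex-norming, then the $2$-edge-colouring $\alpha$ for which $(H,\alpha)$ is complex-norming is unique up to isomorphism: such an $\alpha$ exists, and whenever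 $(H,\beta)$ and $(H,\gamma)$ are both complex-norming, there is an automorphism $\phi$ of $H$, mapping $A$ to $A$ and $B$ to $B$, with $\beta(e)=\gamma(\phi(e))$ for every $e\in E(H)$. -/

import Mathlib

open MeasureTheory
open scoped unitInterval ComplexConjugate

noncomputable section

/-- A finite (simple) bipartite graph with a fixed ordered bipartition into `A` and `B`:
its vertex set is the disjoint union of `A` and `B`, and each edge is written as an
ordered pair `(u, v)` with `u` in `A` and `v` in `B`. -/
structure BipartiteGraph (A B : Type*) where
  /-- the set of (oriented) edges -/
  edges : Finset (A × B)

/-- The class of bounded measurable functions from the unit square to the complex numbers. -/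
def IsBoundedMeasurable (f : I × I → ℂ) : Prop :=
  Measurable f ∧ ∃ C : ℝ, ∀ z, ‖f z‖ ≤ C

/-- `N` is a norm on the complex vector space of bounded measurable functions on the unit
square, where, as usual, functions that agree almost everywhere are identified. -/
structure IsNormOnBoundedMeasurable (N : (I × I → ℂ) → ℝ) : Prop where
  add_le : ∀ f g, IsBoundedMeasurable f → IsBoundedMeasurable g → N (f + g) ≤ N f + N g
  smul_eq : ∀ (c : ℂ) f, IsBoundedMeasurable f → N (c • f) = ‖c‖ * N f
  eq_zero_iff : ∀ f, IsBoundedMeasurable f → (N f = 0 ↔ f =ᵐ[volume] 0)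

namespace BipartiteGraph

/-- A `2`-edge-colouring: a map from the edge set to `{0, 1}`. -/
abbrev EdgeColouring {A B : Type*} (H : BipartiteGraph A B) : Type _ :=
  {e : A × B // e ∈ H.edges} → Fin 2

section Functional

variable {A B : Type*} [Fintype A] [Fintype B] (H : BipartiteGraph A B)

/-- The functional `t_{H,α}(f)`, the integral over one independent uniform point of `[0,1]`
for each vertex of the product over the edges `e = (u, v)` of `f(x_u, y_v)` if `e` has
colour `1`, and of its complex conjugate if `e` has colour `0`. -/
def colouredDensity (α : H.EdgeColouring) (f : I × I → ℂ) : ℂ :=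
  ∫ p : (A → I) × (B → I),
    ∏ e : {e : A × B // e ∈ H.edges},
      f (p.1 e.1.1, p.2 e.1.2) ^ (α e : ℕ) * conj (f (p.1 e.1.1, p.2 e.1.2)) ^ (1 - (α e : ℕ))

/-- `‖f‖_{H,α} = |t_{H,α}(f)| ^ (1 / e(H))`. -/
def colouredNorm (α : H.EdgeColouring) (f : I × I → ℂ) : ℝ :=
  ‖H.colouredDensity α f‖ ^ (1 / (H.edges.card : ℝ))

/-- The `2`-coloured graph `(H, α)` is complex-norming. -/
def IsComplexNormingWith (α : H.EdgeColouring) : Prop :=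
  IsNormOnBoundedMeasurable (H.colouredNorm α)

/-- `H` is complex-norming: some `2`-edge-colouring makes it complex-norming. -/
def IsComplexNorming : Prop :=
  ∃ α : H.EdgeColouring, H.IsComplexNormingWith α

end Functional

/-- The `2`-coloured graphs `(H, α)` and `(G, β)` are isomorphic: there is a graph isomorphism
(respecting the ordered bipartitions) that preserves the colours of the edges. -/
def ColouredIso {A B A' B' : Type*} (H : BipartiteGraph A B) (α : H.EdgeColouring)
    (G : BipartiteGraph A' B') (β : G.EdgeColouring) : Prop :=
  ∃ (φ : A ≃ A') (ψ : B ≃ B')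
    (h : ∀ u v, (u, v) ∈ H.edges ↔ (φ u, ψ v) ∈ G.edges),
    ∀ u v (huv : (u, v) ∈ H.edges), α ⟨(u, v), huv⟩ = β ⟨(φ u, ψ v), (h u v).1 huv⟩

end BipartiteGraph

end

universe v w

/-! Step functions reduce everything to finite matrices, where `t_{H,α}` becomes, up to
normalisation, `homSum`. It is multiplicative under Kronecker products and additive, up to positive
weights, on block diagonal matrices when the edges form one component. Let `β` and `γ` both be
norming. The sum for `F + conj F` under one colouring is the sum over all colourings for `F`, so the
triangle inequality on tensor powers of `M ⊗ conj M` gives `|t_γ(M)| ≤ |t_β(M)|` (`norm_homSum_le`),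
hence equality of moduli by symmetry. Definiteness of the norm forces `t_β(M)` to be a positive real
for `M ≠ 0` (`homSum_eq_norm`): otherwise a tensor power has a negative value, and a constant block
can be added to cancel it. So `t_β = t_γ` on all matrices. Finally, the sum for a generic matrix
indexed by `A` and `B` is a polynomial in the entries and their conjugates. Comparing the monomial
of the identity map yields the colour-preserving automorphism (`exists_map_of_homSum_eq`). -/

/-- The identity of `ℂ` for the colour `1`, complex conjugation for the colour `0`. -/
noncomputable def twist (c : Fin 2) : ℂ →+* ℂ :=
  if c = 1 then RingHom.id ℂ else starRingEnd ℂ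

@[simp] theorem twist_one : twist 1 = RingHom.id ℂ := rfl

@[simp] theorem twist_zero : twist 0 = starRingEnd ℂ := rfl

theorem twist_conj (c : Fin 2) (z : ℂ) : twist c (conj z) = conj (twist c z) := by
  fin_cases c <;> simp

theorem twist_eq_pow_mul_pow (c : Fin 2) (z : ℂ) :
    twist c z = z ^ (c : ℕ) * conj z ^ (1 - (c : ℕ)) := by
  fin_cases c <;> simp

theorem twist_add_conj (c : Fin 2) (z : ℂ) : twist c (z + conj z) = ∑ x, twist x z := by
  fin_cases c <;> simp [add_comm]

theorem twist_ofReal (c : Fin 2) (r : ℝ) : twist c (r : ℂ) = r := by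
  fin_cases c <;> simp

theorem continuous_twist (c : Fin 2) : Continuous (twist c) := by
  fin_cases c
  · exact Complex.continuous_conj
  · exact continuous_id

/-! ### Coloured homomorphism sums of matrices -/

section HomSum

variable {A B ε ι κ ι' κ' : Type*} [Fintype A] [Fintype B] [Fintype ε]

/-- The weight of the map `p` from a bipartite multigraph, with edges `s e` coloured by `c`, to a
matrix `M`. -/
noncomputable def homWeight (s : ε → A × B) (c : ε → Fin 2) (M : ι → κ → ℂ)
    (p : (A → ι) × (B → κ)) : ℂ :=
  ∏ e, twist (c e) (M (p.1 (s e).1) (p.2 (s e).2))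

open scoped Classical in
/-- The sum of the weights of all maps from a coloured bipartite multigraph to a matrix. -/
noncomputable def homSum [Fintype ι] [Fintype κ] (s : ε → A × B) (c : ε → Fin 2)
    (M : ι → κ → ℂ) : ℂ :=
  ∑ p : (A → ι) × (B → κ), homWeight s c M p

variable [Fintype ι] [Fintype κ] [Fintype ι'] [Fintype κ']

/-- The Kronecker product of matrices. -/
def tensor (M : ι → κ → ℂ) (N : ι' → κ' → ℂ) : ι × ι' → κ × κ' → ℂ :=
  fun i j => M i.1 j.1 * N i.2 j.2

theorem homSum_tensor (s : ε → A × B) (c : ε → Fin 2) (M : ι → κ → ℂ) (N : ι' → κ' → ℂ) :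
    homSum s c (tensor M N) = homSum s c M * homSum s c N := by
  classical
  let E : ((A → ι × ι') × (B → κ × κ')) ≃ ((A → ι) × (B → κ)) × ((A → ι') × (B → κ')) :=
    ((Equiv.arrowProdEquivProdArrow A (fun _ => ι) (fun _ => ι')).prodCongr
      (Equiv.arrowProdEquivProdArrow B (fun _ => κ) (fun _ => κ'))).trans
      (Equiv.prodProdProdComm _ _ _ _)
  unfold homSum
  rw [Finset.sum_mul_sum, ← Finset.sum_product', Finset.univ_product_univ]
  refine Fintype.sum_equiv E _ _ fun p => ?_
  simp only [homWeight, ← Finset.prod_mul_distrib, ← map_mul]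
  rfl

theorem homSum_conj (s : ε → A × B) (c : ε → Fin 2) (M : ι → κ → ℂ) :
    homSum s c (fun i j => conj (M i j)) = conj (homSum s c M) := by
  simp [homSum, homWeight, twist_conj, map_sum, map_prod]

theorem homSum_const (s : ε → A × B) (c : ε → Fin 2) (r : ℝ) :
    homSum s c (fun (_ : ι) (_ : κ) => (r : ℂ)) =
      ((Fintype.card ι : ℝ) ^ Fintype.card A * (Fintype.card κ : ℝ) ^ Fintype.card B *
        r ^ Fintype.card ε : ℝ) := by
  classical
  simp [homSum, homWeight, twist_ofReal]

/-- `z + conj z` is fixed by conjugation, so the left side forgets `c`; expanding the product over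
edges makes every colouring appear once. -/
theorem homSum_add_conj [DecidableEq ε] (s : ε → A × B) (c : ε → Fin 2) (M : ι → κ → ℂ) :
    homSum s c (fun i j => M i j + conj (M i j)) = ∑ γ : ε → Fin 2, homSum s γ M := by
  simp only [homSum, homWeight, twist_add_conj]
  rw [Finset.sum_comm]
  refine Finset.sum_congr rfl fun p _ => ?_
  rw [Finset.prod_univ_sum, Fintype.piFinset_univ]

theorem continuous_homSum (s : ε → A × B) (c : ε → Fin 2) :
    Continuous (fun M : ι → κ → ℂ => homSum s c M) := by
  unfold homSum homWeight
  refine continuous_finsetSum _ fun p _ => continuous_finsetProd _ fun e _ => ?_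
  exact (continuous_twist _).comp (by fun_prop)

end HomSum


/-- `M'` is the `k`-th tensor power of `M`. One matrix serves all colourings at once, and it stays
in the universes of `M`, so universe-bound hypotheses on matrices apply to it. -/
theorem exists_homSum_eq_pow {A B ε : Type*} [Fintype A] [Fintype B] [Fintype ε]
    {ι : Type v} {κ : Type w} [Fintype ι] [Fintype κ] (M : ι → κ → ℂ) (hM : M ≠ 0) (k : ℕ) :
    ∃ (ι' : Type v) (κ' : Type w) (_ : Fintype ι') (_ : Fintype κ') (M' : ι' → κ' → ℂ), M' ≠ 0 ∧
      ∀ (s : ε → A × B) (c : ε → Fin 2), homSum s c M' = homSum s c M ^ k := by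
  induction k with
  | zero =>
    refine ⟨PUnit, PUnit, inferInstance, inferInstance, fun _ _ => ((1 : ℝ) : ℂ), ?_, ?_⟩
    · intro h
      simpa using congrFun (congrFun h PUnit.unit) PUnit.unit
    · intro s c
      rw [homSum_const]
      simp
  | succ k ih =>
    obtain ⟨ι', κ', _, _, M', h0, h⟩ := ih
    refine ⟨ι' × ι, κ' × κ, inferInstance, inferInstance, tensor M' M, ?_, ?_⟩
    · simp only [ne_eq, funext_iff, not_forall, Pi.zero_apply] at h0 hM ⊢
      obtain ⟨i', j', h'⟩ := h0
      obtain ⟨i, j, h''⟩ := hM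
      exact ⟨(i', i), (j', j), mul_ne_zero h' h''⟩
    · intro s c
      rw [homSum_tensor, h, pow_succ]

/-! ### Positivity of non-vanishing sums -/

/-- Either `C` meets the negative real axis, or `arg` is continuous on `C` and takes every value
between `0` and `arg w ≠ 0`, among them `π / k` or `-π / k` for large `k`. -/
theorem exists_pow_eq_neg_of_isPreconnected {C : Set ℂ} (hC : IsPreconnected C) (h0 : (0 : ℂ) ∉ C)
    {r : ℝ} (hr : 0 < r) (hrC : (r : ℂ) ∈ C) {w : ℂ} (hwC : w ∈ C) (hw : w ≠ (‖w‖ : ℂ)) :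
    ∃ z ∈ C, ∃ k : ℕ, ∃ ρ : ℝ, 0 < ρ ∧ z ^ k = -(ρ : ℂ) := by
  by_cases hsl : C ⊆ Complex.slitPlane
  · have hpre : (Complex.arg '' C).OrdConnected :=
      (hC.image _ fun z hz =>
        (Complex.continuousAt_arg (hsl hz)).continuousWithinAt).ordConnected
    have hzero : (0 : ℝ) ∈ Complex.arg '' C := ⟨r, hrC, Complex.arg_ofReal_of_nonneg hr.le⟩
    have hwa : w.arg ∈ Complex.arg '' C := ⟨w, hwC, rfl⟩
    have hne : w.arg ≠ 0 := by
      intro h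
      apply hw
      conv_lhs => rw [← Complex.norm_mul_exp_arg_mul_I w, h]
      simp
    obtain ⟨k, hk⟩ := exists_nat_gt (Real.pi / |w.arg|)
    have habs : 0 < |w.arg| := abs_pos.2 hne
    have hk0 : (0 : ℝ) < k := (div_pos Real.pi_pos habs).trans hk
    have hle : Real.pi / k ≤ |w.arg| := by
      rw [div_lt_iff₀ habs] at hk
      rw [div_le_iff₀ hk0]
      linarith
    have hpk : 0 < Real.pi / k := div_pos Real.pi_pos hk0
    have hkc : (k : ℂ) ≠ 0 := by exact_mod_cast hk0.ne'
    obtain ⟨θ, ⟨z, hz, rfl⟩, hexp⟩ :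
        ∃ θ ∈ Complex.arg '' C, Complex.exp (k * (θ * Complex.I)) = -1 := by
      rcases hne.lt_or_gt with hneg | hpos
      · rw [abs_of_neg hneg] at hle
        refine ⟨-(Real.pi / k), hpre.out hwa hzero ⟨by linarith, by linarith⟩, ?_⟩
        have : (k : ℂ) * (((-(Real.pi / k) : ℝ) : ℂ) * Complex.I) = -(Real.pi * Complex.I) := by
          push_cast
          field_simp
        rw [this, Complex.exp_neg, Complex.exp_pi_mul_I]
        norm_num
      · rw [abs_of_pos hpos] at hle
        refine ⟨Real.pi / k, hpre.out hzero hwa ⟨by linarith, by linarith⟩, ?_⟩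
        have : (k : ℂ) * (((Real.pi / k : ℝ) : ℂ) * Complex.I) = Real.pi * Complex.I := by
          push_cast
          field_simp
        rw [this, Complex.exp_pi_mul_I]
    have hz0 : z ≠ 0 := fun h => h0 (h ▸ hz)
    refine ⟨z, hz, k, ‖z‖ ^ k, by positivity, ?_⟩
    conv_lhs => rw [← Complex.norm_mul_exp_arg_mul_I z]
    rw [mul_pow, ← Complex.exp_nat_mul, hexp]
    push_cast
    ring
  · obtain ⟨z, hz, hzs⟩ := Set.not_subset.1 hsl
    rw [Complex.mem_slitPlane_iff, not_or, not_not, not_lt] at hzs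
    have hre : z = (z.re : ℂ) := Complex.ext (by simp) (by simp [hzs.2])
    refine ⟨z, hz, 1, -z.re, ?_, ?_⟩
    · rcases hzs.1.lt_or_eq with h | h
      · linarith
      · exact absurd (by rw [hre, h, Complex.ofReal_zero] at hz; exact hz) h0
    · rw [pow_one]
      conv_lhs => rw [hre]
      simp

section Blocks

variable {A B ε ι κ : Type*} [Fintype A] [Fintype B] [Fintype ε] [Fintype ι] [Fintype κ]

/-- The block diagonal matrix with blocks `F` and `G` of the same shape. -/
def blockSum (F G : ι → κ → ℂ) : Bool × ι → Bool × κ → ℂ :=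
  fun i j => if i.1 = j.1 then (if i.1 = true then F i.2 j.2 else G i.2 j.2) else 0

/-- The edges `e ∈ S` are vertex-disjoint from the edges `e ∉ S`. -/
def IsCut (s : ε → A × B) (S : Set ε) : Prop :=
  ∀ e ∈ S, ∀ e' ∉ S, (s e).1 ≠ (s e').1 ∧ (s e).2 ≠ (s e').2

/-- A map of nonzero weight sends the two ends of each edge to the same block, hence, by
connectedness, all edges to one block. Isolated vertices choose their block freely, so `a` and `b`
can exceed `1`. -/
theorem exists_homSum_blockSum [Nonempty ε] (s : ε → A × B) (c : ε → Fin 2)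
    (hs : ∀ S : Set ε, IsCut s S → S = ∅ ∨ S = Set.univ) :
    ∃ a b : ℕ, 0 < a ∧ 0 < b ∧ ∀ F G : ι → κ → ℂ,
      homSum s c (blockSum F G) = a * homSum s c F + b * homSum s c G := by
  classical
  let P (x : Bool) (l : (A → Bool) × (B → Bool)) : Prop :=
    ∀ e, l.1 (s e).1 = x ∧ l.2 (s e).2 = x
  let E : ((A → Bool × ι) × (B → Bool × κ)) ≃ ((A → Bool) × (B → Bool)) × ((A → ι) × (B → κ)) :=
    ((Equiv.arrowProdEquivProdArrow A (fun _ => Bool) (fun _ => ι)).prodCongr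
      (Equiv.arrowProdEquivProdArrow B (fun _ => Bool) (fun _ => κ))).trans
      (Equiv.prodProdProdComm _ _ _ _)
  have hdisj : ∀ l, P true l → ¬ P false l := fun l h1 h2 => by
    obtain ⟨e⟩ := ‹Nonempty ε›
    simpa [(h1 e).1] using (h2 e).1
  refine ⟨(Finset.univ.filter (P true)).card, (Finset.univ.filter (P false)).card,
    Finset.card_pos.2 ⟨(fun _ => true, fun _ => true), by simp [P]⟩,
    Finset.card_pos.2 ⟨(fun _ => false, fun _ => false), by simp [P]⟩, fun F G => ?_⟩
  have key : ∀ (l : (A → Bool) × (B → Bool)) (q : (A → ι) × (B → κ)),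
      homWeight s c (blockSum F G) (E.symm (l, q)) =
        (if P true l then homWeight s c F q else 0) +
          (if P false l then homWeight s c G q else 0) := by
    intro l q
    have hE : homWeight s c (blockSum F G) (E.symm (l, q)) =
        ∏ e, twist (c e) (blockSum F G (l.1 (s e).1, q.1 (s e).1) (l.2 (s e).2, q.2 (s e).2)) :=
      rfl
    rw [hE]
    by_cases ht : P true l
    · rw [if_pos ht, if_neg (hdisj l ht), add_zero]
      refine Finset.prod_congr rfl fun e _ => ?_
      simp [blockSum, (ht e).1, (ht e).2]
    · by_cases hf : P false l
      · rw [if_neg ht, if_pos hf, zero_add]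
        refine Finset.prod_congr rfl fun e _ => ?_
        simp [blockSum, (hf e).1, (hf e).2]
      · rw [if_neg ht, if_neg hf, add_zero]
        suffices ∃ e, l.1 (s e).1 ≠ l.2 (s e).2 by
          obtain ⟨e, he⟩ := this
          exact Finset.prod_eq_zero (Finset.mem_univ e) (by simp [blockSum, he])
        by_contra! hall
        rcases hs {e | l.1 (s e).1 = true} (by
          intro e he e' he'
          simp only [Set.mem_ofPred_eq] at he he'
          refine ⟨fun h => he' (h ▸ he), fun h => he' ?_⟩
          rw [hall, ← h, ← hall, he]) with h | h
        · refine hf fun e => ?_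
          have h1 : l.1 (s e).1 = false := by
            simpa using (Set.eq_empty_iff_forall_notMem.1 h e : ¬ l.1 (s e).1 = true)
          exact ⟨h1, hall e ▸ h1⟩
        · refine ht fun e => ?_
          have h1 : l.1 (s e).1 = true := Set.eq_univ_iff_forall.1 h e
          exact ⟨h1, hall e ▸ h1⟩
  have h1 : homSum s c (blockSum F G) =
      ∑ l, ∑ q, homWeight s c (blockSum F G) (E.symm (l, q)) := by
    rw [← Finset.sum_product', Finset.univ_product_univ]
    exact (Equiv.sum_comp E.symm _).symm
  rw [h1]
  simp only [key, Finset.sum_add_distrib]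
  have hcount : ∀ x (X : (A → ι) × (B → κ) → ℂ),
      ∑ l, ∑ q, (if P x l then X q else 0) = (Finset.univ.filter (P x)).card * ∑ q, X q := by
    intro x X
    rw [Finset.sum_comm, Finset.mul_sum]
    refine Finset.sum_congr rfl fun q _ => ?_
    rw [← Finset.sum_filter, Finset.sum_const, nsmul_eq_mul]
  rw [hcount, hcount, homSum, homSum]

-- Both factors keep all the vertices, so each pair of maps carries redundant values; exchanging the
-- two maps on the vertices of `S` turns the pair into one map for the whole graph and one
-- unconstrained map.
open scoped Classical in
theorem homSum_mul_homSum_of_isCut (s : ε → A × B) (c : ε → Fin 2) {S : Set ε} (hS : IsCut s S)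
    (M : ι → κ → ℂ) :
    homSum (fun e : {e // e ∈ S} => s e) (fun e => c e) M *
      homSum (fun e : {e // e ∉ S} => s e) (fun e => c e) M =
    (Fintype.card ι ^ Fintype.card A * Fintype.card κ ^ Fintype.card B : ℕ) * homSum s c M := by
  let U : Set A := {a | ∃ e ∈ S, (s e).1 = a}
  let V : Set B := {b | ∃ e ∈ S, (s e).2 = b}
  let mix (p q : (A → ι) × (B → κ)) : (A → ι) × (B → κ) :=
    (fun a => if a ∈ U then p.1 a else q.1 a, fun b => if b ∈ V then p.2 b else q.2 b)
  let swap (x : ((A → ι) × (B → κ)) × ((A → ι) × (B → κ))) := (mix x.1 x.2, mix x.2 x.1)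
  have hswap : Function.Involutive swap := by
    rintro ⟨p, q⟩
    simp only [swap, mix]
    ext a <;> simp only <;> split_ifs <;> rfl
  have hmix : ∀ p q, homWeight (fun e : {e // e ∈ S} => s e) (fun e => c e) M p *
      homWeight (fun e : {e // e ∉ S} => s e) (fun e => c e) M q = homWeight s c M (mix p q) := by
    intro p q
    rw [homWeight, homWeight, homWeight, ← Fintype.prod_subtype_mul_prod_subtype (fun e => e ∈ S)]
    congr 1
    · refine Finset.prod_congr rfl fun e _ => ?_
      have h1 : (s e).1 ∈ U := ⟨e, e.2, rfl⟩
      have h2 : (s e).2 ∈ V := ⟨e, e.2, rfl⟩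
      simp [mix, h1, h2]
    · refine Finset.prod_congr rfl fun e _ => ?_
      have h1 : (s e).1 ∉ U := by
        rintro ⟨e', he', h⟩
        exact (hS e' he' e e.2).1 h
      have h2 : (s e).2 ∉ V := by
        rintro ⟨e', he', h⟩
        exact (hS e' he' e e.2).2 h
      simp [mix, h1, h2]
  unfold homSum
  rw [Finset.sum_mul_sum]
  simp only [hmix]
  rw [← Finset.sum_product', Finset.univ_product_univ]
  have h2 := Equiv.sum_comp (hswap.toPerm swap) (fun x => homWeight s c M x.1)
  refine h2.trans ?_
  rw [Fintype.sum_prod_type]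
  simp [Finset.mul_sum]

end Blocks

theorem homSum_eq_norm_of_connected {A B ε : Type*} [Fintype A] [Fintype B] [Fintype ε]
    [Nonempty ε] (s : ε → A × B) (c : ε → Fin 2)
    (hs : ∀ S : Set ε, IsCut s S → S = ∅ ∨ S = Set.univ)
    (hne : ∀ (ι : Type v) (κ : Type w) [Fintype ι] [Fintype κ] (M : ι → κ → ℂ),
      M ≠ 0 → homSum s c M ≠ 0)
    {ι : Type v} {κ : Type w} [Fintype ι] [Fintype κ] (M : ι → κ → ℂ) (hM : M ≠ 0) :
    homSum s c M = (‖homSum s c M‖ : ℂ) := by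
  by_contra hcon
  have hex : ∃ i j, M i j ≠ 0 := by
    simpa [funext_iff] using hM
  obtain ⟨i₀, j₀, -⟩ := hex
  have : Nonempty ι := ⟨i₀⟩
  have : Nonempty κ := ⟨j₀⟩
  have hcι : 0 < (Fintype.card ι : ℝ) := by exact_mod_cast Fintype.card_pos
  have hcκ : 0 < (Fintype.card κ : ℝ) := by exact_mod_cast Fintype.card_pos
  -- Real dimension at least two makes the set of nonzero matrices connected.
  have hrank : 1 < Module.rank ℝ (ι → κ → ℂ) := by
    rw [← Module.finrank_eq_rank]
    norm_cast
    simp only [Module.finrank_pi_fintype, Complex.finrank_real_complex, Finset.sum_const,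
      Finset.card_univ, smul_eq_mul]
    have h1 : 0 < Fintype.card ι := Fintype.card_pos
    have h2 : 0 < Fintype.card κ := Fintype.card_pos
    nlinarith [Nat.mul_pos h1 h2]
  have hconn := (isConnected_compl_singleton_of_one_lt_rank hrank (0 : ι → κ → ℂ)).isPreconnected
  have himg := hconn.image (fun M => homSum s c M) (continuous_homSum s c).continuousOn
  obtain ⟨_, ⟨N, hN, rfl⟩, k, ρ, hρ, hpow⟩ := exists_pow_eq_neg_of_isPreconnected himg
    (r := (Fintype.card ι : ℝ) ^ Fintype.card A * (Fintype.card κ : ℝ) ^ Fintype.card B *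
        1 ^ Fintype.card ε)
    (by rintro ⟨N, hN, h⟩; exact hne ι κ N hN h) (by positivity)
    ⟨fun _ _ => ((1 : ℝ) : ℂ), fun h => by simpa using congrFun (congrFun h i₀) j₀,
      homSum_const s c 1⟩ ⟨M, hM, rfl⟩ hcon
  obtain ⟨ι', κ', _, _, F, hF, hFk⟩ := exists_homSum_eq_pow (ε := ε) (A := A) (B := B) N hN k
  have hFs : homSum s c F = -(ρ : ℂ) := (hFk s c).trans hpow
  have hexF : ∃ i j, F i j ≠ 0 := by
    simpa [funext_iff] using hF
  obtain ⟨i, j, hij⟩ := hexF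
  have : Nonempty ι' := ⟨i⟩
  have : Nonempty κ' := ⟨j⟩
  have hcι' : 0 < (Fintype.card ι' : ℝ) := by exact_mod_cast Fintype.card_pos
  have hcκ' : 0 < (Fintype.card κ' : ℝ) := by exact_mod_cast Fintype.card_pos
  obtain ⟨a, b, ha, hb, hab⟩ := exists_homSum_blockSum (ι := ι') (κ := κ') s c hs
  have ha' : (0 : ℝ) < a := by exact_mod_cast ha
  have hb' : (0 : ℝ) < b := by exact_mod_cast hb
  let K : ℝ := (Fintype.card ι' : ℝ) ^ Fintype.card A * (Fintype.card κ' : ℝ) ^ Fintype.card B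
  have hK : 0 < K := by positivity
  -- Chosen so that the constant block contributes `b * K * t ^ |ε| = a * ρ`, cancelling the `-a *
  -- ρ` of the block `F`.
  let t : ℝ := (a * ρ / (b * K)) ^ ((Fintype.card ε : ℝ)⁻¹)
  have ht : t ^ Fintype.card ε = a * ρ / (b * K) :=
    Real.rpow_inv_natCast_pow (by positivity) Fintype.card_ne_zero
  refine hne _ _ (blockSum F fun _ _ => (t : ℂ)) (fun h => hij ?_) ?_
  · simpa [blockSum] using congrFun (congrFun h (true, i)) (true, j)
  · rw [hab, hFs, homSum_const, ht]
    have : (a : ℝ) * (-ρ) + b * (K * (a * ρ / (b * K))) = 0 := by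
      field_simp
      ring
    have h := congrArg (fun x : ℝ => (x : ℂ)) this
    simp only [K] at h ⊢
    push_cast at h ⊢
    linear_combination h

/-- Induction on the number of edges: a nontrivial cut writes the sum, up to a positive factor, as a
product of two sums with fewer edges, neither of which vanishes. -/
theorem homSum_eq_norm {A B : Type*} [Fintype A] [Fintype B] {ε : Type*} [Fintype ε]
    (s : ε → A × B) (c : ε → Fin 2)
    (hne : ∀ (ι : Type v) (κ : Type w) [Fintype ι] [Fintype κ] (M : ι → κ → ℂ),
      M ≠ 0 → homSum s c M ≠ 0)
    {ι : Type v} {κ : Type w} [Fintype ι] [Fintype κ] (M : ι → κ → ℂ) (hM : M ≠ 0) :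
    homSum s c M = (‖homSum s c M‖ : ℂ) := by
  classical
  induction hn : Fintype.card ε using Nat.strong_induction_on generalizing ε ι κ with
  | _ n ih =>
  rcases isEmpty_or_nonempty ε with hε | hε
  · simp [homSum, homWeight]
  by_cases hs : ∀ S : Set ε, IsCut s S → S = ∅ ∨ S = Set.univ
  · exact homSum_eq_norm_of_connected s c hs hne M hM
  · push Not at hs
    obtain ⟨S, hS, hS0, hS1⟩ := hs
    have hcut := fun {ι : Type v} {κ : Type w} [Fintype ι] [Fintype κ] (M : ι → κ → ℂ) =>
      homSum_mul_homSum_of_isCut s c hS M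
    have hpos : ∀ {ι : Type v} {κ : Type w} [Fintype ι] [Fintype κ] (M : ι → κ → ℂ), M ≠ 0 →
        Fintype.card ι ^ Fintype.card A * Fintype.card κ ^ Fintype.card B ≠ 0 := by
      intro ι κ _ _ M hM
      have hex : ∃ i j, M i j ≠ 0 := by
        simpa [funext_iff] using hM
      obtain ⟨i, j, -⟩ := hex
      have : Nonempty ι := ⟨i⟩
      have : Nonempty κ := ⟨j⟩
      exact mul_ne_zero (pow_ne_zero _ Fintype.card_ne_zero) (pow_ne_zero _ Fintype.card_ne_zero)
    have hne' : ∀ (ι : Type v) (κ : Type w) [Fintype ι] [Fintype κ] (M : ι → κ → ℂ), M ≠ 0 →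
        homSum (fun e : {e // e ∈ S} => s e) (fun e => c e) M *
          homSum (fun e : {e // e ∉ S} => s e) (fun e => c e) M ≠ 0 := by
      intro ι κ _ _ M hM
      rw [hcut]
      exact mul_ne_zero (by exact_mod_cast hpos M hM) (hne _ _ M hM)
    obtain ⟨e₁, he₁⟩ := hS0
    obtain ⟨e₀, he₀⟩ := (Set.ne_univ_iff_exists_notMem S).1 hS1
    have h1 := ih _ (hn ▸ Fintype.card_subtype_lt (p := fun e => e ∈ S) he₀)
      (fun e : {e // e ∈ S} => s e) (fun e => c e)
      (fun ι κ _ _ M hM => left_ne_zero_of_mul (hne' ι κ M hM)) M hM rfl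
    have h2 := ih _ (hn ▸ Fintype.card_subtype_lt (p := fun e => e ∉ S) (x := e₁) (by simpa))
      (fun e : {e // e ∉ S} => s e) (fun e => c e)
      (fun ι κ _ _ M hM => right_ne_zero_of_mul (hne' ι κ M hM)) M hM rfl
    have h3 := hcut M
    rw [h1, h2] at h3
    have h4 : ((Fintype.card ι ^ Fintype.card A * Fintype.card κ ^ Fintype.card B : ℕ) : ℂ) ≠ 0 :=
      by exact_mod_cast hpos M hM
    have h5 := (eq_div_iff h4).2 ((mul_comm _ _).trans h3.symm)
    rw [h5]
    simp

/-! ### From matrices to step functions on the unit square -/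

theorem exists_uniform_labelling_fin (n : ℕ) :
    ∃ c : I → Fin (n + 1), Measurable c ∧ ∀ i, volume.real (c ⁻¹' {i}) = ((n + 1 : ℕ) : ℝ)⁻¹ := by
  have hn : (0 : ℝ) < n + 1 := by positivity
  -- The cap at `n` only affects `x = 1`, so the last class is a closed interval and is measured
  -- separately.
  refine ⟨fun x => ⟨min ⌊((n : ℝ) + 1) * (x : ℝ)⌋₊ n, by omega⟩, ?_, fun i => ?_⟩
  · have h1 : Measurable (fun k : ℕ => (⟨min k n, by omega⟩ : Fin (n + 1))) :=
      measurable_from_nat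
    exact h1.comp (Nat.measurable_floor.comp (by fun_prop))
  · have hi : (i : ℝ) ≤ n := by exact_mod_cast Nat.lt_succ_iff.1 i.2
    let a : I := ⟨i / (n + 1), by positivity, by rw [div_le_one hn]; linarith⟩
    have hfloor : ∀ x : I, (a ≤ x ↔ (i : ℕ) ≤ ⌊((n : ℝ) + 1) * (x : ℝ)⌋₊) := fun x => by
      rw [Nat.le_floor_iff (mul_nonneg hn.le x.2.1), ← Subtype.coe_le_coe, div_le_iff₀ hn, mul_comm]
    rcases (Nat.lt_succ_iff.1 i.2).lt_or_eq with hlt | heq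
    · have hi' : (i : ℝ) + 1 ≤ n := by exact_mod_cast hlt
      let b : I := ⟨(i + 1) / (n + 1), by positivity, by rw [div_le_one hn]; linarith⟩
      have hfloor' : ∀ x : I, (x < b ↔ ⌊((n : ℝ) + 1) * (x : ℝ)⌋₊ < (i : ℕ) + 1) := fun x => by
        rw [Nat.floor_lt (mul_nonneg hn.le x.2.1), ← Subtype.coe_lt_coe, lt_div_iff₀ hn, mul_comm]
        push_cast
        rfl
      have hpre : (fun x : I => (⟨min ⌊((n : ℝ) + 1) * (x : ℝ)⌋₊ n, by omega⟩ : Fin (n + 1))) ⁻¹'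
          {i} = Set.Ico a b := by
        ext x
        simp only [Set.mem_preimage, Set.mem_singleton_iff, Fin.ext_iff, Set.mem_Ico, hfloor,
          hfloor']
        omega
      rw [hpre, measureReal_def, unitInterval.volume_Ico, ENNReal.toReal_ofReal]
      · simp only [a, b]
        push_cast
        field_simp
        ring
      · simp only [a, b, sub_nonneg]
        gcongr
        linarith
    · have hpre : (fun x : I => (⟨min ⌊((n : ℝ) + 1) * (x : ℝ)⌋₊ n, by omega⟩ : Fin (n + 1))) ⁻¹'
          {i} = Set.Ici a := by
        ext x
        simp only [Set.mem_preimage, Set.mem_singleton_iff, Fin.ext_iff, Set.mem_Ici, hfloor]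
        omega
      rw [hpre, measureReal_def, unitInterval.volume_Ici,
        ENNReal.toReal_ofReal (sub_nonneg.2 a.2.2)]
      simp only [a, heq]
      push_cast
      field_simp
      ring

theorem exists_uniform_labelling (ι : Type*) [Fintype ι] [Nonempty ι] [MeasurableSpace ι]
    [MeasurableSingletonClass ι] :
    ∃ c : I → ι, Measurable c ∧ ∀ i, volume.real (c ⁻¹' {i}) = (Fintype.card ι : ℝ)⁻¹ := by
  obtain ⟨n, hn⟩ := Nat.exists_eq_succ_of_ne_zero (Fintype.card_ne_zero (α := ι))
  obtain ⟨c, hc, h⟩ := exists_uniform_labelling_fin n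
  let e := (Fintype.equivFinOfCardEq hn).symm
  refine ⟨e ∘ c, (measurable_of_finite e).comp hc, fun i => ?_⟩
  have : (e ∘ c) ⁻¹' {i} = c ⁻¹' {e.symm i} := by
    ext x
    simp [Equiv.eq_symm_apply]
  rw [this, h, hn]

theorem isBoundedMeasurable_step {ι κ : Type*} [Fintype ι] [Fintype κ] [MeasurableSpace ι]
    [MeasurableSpace κ] [MeasurableSingletonClass ι] [MeasurableSingletonClass κ]
    {c : I → ι} {d : I → κ} (hc : Measurable c) (hd : Measurable d) (M : ι → κ → ℂ) :
    IsBoundedMeasurable (fun z => M (c z.1) (d z.2)) := by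
  have h1 : Measurable (fun q : ι × κ => M q.1 q.2) := measurable_of_finite _
  refine ⟨h1.comp ((hc.comp measurable_fst).prodMk (hd.comp measurable_snd)),
    ∑ i, ∑ j, ‖M i j‖, fun z => ?_⟩
  exact (Finset.single_le_sum (f := fun j => ‖M (c z.1) j‖) (fun _ _ => norm_nonneg _)
    (Finset.mem_univ (d z.2))).trans
    (Finset.single_le_sum (f := fun i => ∑ j, ‖M i j‖)
      (fun _ _ => Finset.sum_nonneg fun _ _ => norm_nonneg _) (Finset.mem_univ (c z.1)))

theorem step_eq_zero {ι κ : Type*} [Fintype ι] [Fintype κ] [Nonempty ι] [Nonempty κ]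
    {c : I → ι} {d : I → κ} (hc : ∀ i, volume.real (c ⁻¹' {i}) = (Fintype.card ι : ℝ)⁻¹)
    (hd : ∀ j, volume.real (d ⁻¹' {j}) = (Fintype.card κ : ℝ)⁻¹) {M : ι → κ → ℂ}
    (h : (fun z : I × I => M (c z.1) (d z.2)) =ᵐ[volume] 0) : M = 0 := by
  by_contra hM
  have hex : ∃ i j, M i j ≠ 0 := by
    simpa [funext_iff] using hM
  obtain ⟨i, j, hij⟩ := hex
  have h0 : volume ((c ⁻¹' {i}) ×ˢ (d ⁻¹' {j})) = 0 := by
    refine measure_mono_null ?_ (ae_iff.1 h)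
    rintro ⟨x, y⟩ ⟨hx, hy⟩
    simp only [Set.mem_preimage, Set.mem_singleton_iff] at hx hy
    simpa [hx, hy] using hij
  rw [Measure.volume_eq_prod, Measure.prod_prod, mul_eq_zero] at h0
  rcases h0 with h0 | h0
  · have h1 := hc i
    rw [measureReal_def, h0, ENNReal.toReal_zero, eq_comm, inv_eq_zero] at h1
    exact Fintype.card_ne_zero (by exact_mod_cast h1)
  · have h1 := hd j
    rw [measureReal_def, h0, ENNReal.toReal_zero, eq_comm, inv_eq_zero] at h1
    exact Fintype.card_ne_zero (by exact_mod_cast h1)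

theorem integral_comp_labelling {A B ι κ : Type*} [Fintype A] [Fintype B] [Fintype ι] [Fintype κ]
    [MeasurableSpace ι] [MeasurableSpace κ] [MeasurableSingletonClass ι]
    [MeasurableSingletonClass κ] [Fintype (A → ι)] [Fintype (B → κ)]
    {c : I → ι} {d : I → κ} (hcm : Measurable c) (hdm : Measurable d)
    (hc : ∀ i, volume.real (c ⁻¹' {i}) = (Fintype.card ι : ℝ)⁻¹)
    (hd : ∀ j, volume.real (d ⁻¹' {j}) = (Fintype.card κ : ℝ)⁻¹)
    (g : (A → ι) × (B → κ) → ℂ) :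
    ∫ p : (A → I) × (B → I), g (c ∘ p.1, d ∘ p.2) =
      ((Fintype.card ι : ℂ) ^ Fintype.card A * (Fintype.card κ : ℂ) ^ Fintype.card B)⁻¹ *
        ∑ q, g q := by
  have hcA : Measurable (fun p : A → I => c ∘ p) :=
    measurable_pi_lambda _ fun a => hcm.comp (measurable_pi_apply a)
  have hdB : Measurable (fun p : B → I => d ∘ p) :=
    measurable_pi_lambda _ fun b => hdm.comp (measurable_pi_apply b)
  have hmeas : Measurable (fun p : (A → I) × (B → I) => (c ∘ p.1, d ∘ p.2)) :=
    (hcA.comp measurable_fst).prodMk (hdB.comp measurable_snd)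
  have h1 : ∫ p : (A → I) × (B → I), g (c ∘ p.1, d ∘ p.2) =
      ∫ q, g q ∂(volume.map fun p : (A → I) × (B → I) => (c ∘ p.1, d ∘ p.2)) :=
    (integral_map hmeas.aemeasurable (measurable_of_finite g).aestronglyMeasurable).symm
  have : IsProbabilityMeasure (volume.map fun p : (A → I) × (B → I) => (c ∘ p.1, d ∘ p.2)) :=
    Measure.isProbabilityMeasure_map hmeas.aemeasurable
  rw [h1, integral_fintype .of_finite, Finset.mul_sum]
  refine Finset.sum_congr rfl fun q _ => ?_
  rw [measureReal_def, Measure.map_apply hmeas (measurableSet_singleton q)]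
  have hpre : (fun p : (A → I) × (B → I) => (c ∘ p.1, d ∘ p.2)) ⁻¹' {q} =
      (Set.univ.pi fun a => c ⁻¹' {q.1 a}) ×ˢ (Set.univ.pi fun b => d ⁻¹' {q.2 b}) := by
    ext p
    simp [Prod.ext_iff, funext_iff]
  rw [hpre, Measure.volume_eq_prod, Measure.prod_prod, volume_pi_pi, volume_pi_pi,
    ENNReal.toReal_mul, ENNReal.toReal_prod, ENNReal.toReal_prod]
  simp only [← measureReal_def, hc, hd, Finset.prod_const, Finset.card_univ, Complex.real_smul]
  push_cast
  rw [mul_inv, inv_pow, inv_pow]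

namespace BipartiteGraph

variable {A B : Type*} [Fintype A] [Fintype B] {H : BipartiteGraph A B}

theorem colouredDensity_step {ι κ : Type*} [Fintype ι] [Fintype κ] [MeasurableSpace ι]
    [MeasurableSpace κ] [MeasurableSingletonClass ι] [MeasurableSingletonClass κ]
    {c : I → ι} {d : I → κ} (hcm : Measurable c) (hdm : Measurable d)
    (hc : ∀ i, volume.real (c ⁻¹' {i}) = (Fintype.card ι : ℝ)⁻¹)
    (hd : ∀ j, volume.real (d ⁻¹' {j}) = (Fintype.card κ : ℝ)⁻¹)
    (α : H.EdgeColouring) (M : ι → κ → ℂ) :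
    H.colouredDensity α (fun z => M (c z.1) (d z.2)) =
      ((Fintype.card ι : ℂ) ^ Fintype.card A * (Fintype.card κ : ℂ) ^ Fintype.card B)⁻¹ *
        homSum Subtype.val α M := by
  classical
  rw [homSum, ← integral_comp_labelling hcm hdm hc hd, colouredDensity]
  simp only [homWeight, twist_eq_pow_mul_pow, Function.comp_apply]

theorem IsComplexNormingWith.card_ne_zero {α : H.EdgeColouring} (h : H.IsComplexNormingWith α) :
    H.edges.card ≠ 0 := by
  intro h0
  have h1 := (h.eq_zero_iff 0 ⟨measurable_const, 0, by simp⟩).2 (ae_eq_refl _)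
  -- Without edges the exponent is `1 / 0 = 0`, so the zero function would have norm `1`.
  simp [colouredNorm, h0] at h1

theorem IsComplexNormingWith.homSum_ne_zero {α : H.EdgeColouring} (h : H.IsComplexNormingWith α)
    {ι κ : Type*} [Fintype ι] [Fintype κ] {M : ι → κ → ℂ} (hM : M ≠ 0) :
    homSum Subtype.val α M ≠ 0 := by
  intro h0
  apply hM
  rcases isEmpty_or_nonempty ι with hι | hι
  · exact Subsingleton.elim _ _
  rcases isEmpty_or_nonempty κ with hκ | hκ
  · exact Subsingleton.elim _ _
  let : MeasurableSpace ι := ⊤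
  let : MeasurableSpace κ := ⊤
  obtain ⟨c, hcm, hc⟩ := exists_uniform_labelling ι
  obtain ⟨d, hdm, hd⟩ := exists_uniform_labelling κ
  refine step_eq_zero hc hd ((h.eq_zero_iff _ (isBoundedMeasurable_step hcm hdm M)).1 ?_)
  have hpos : 1 / (H.edges.card : ℝ) ≠ 0 :=
    one_div_ne_zero (by exact_mod_cast h.card_ne_zero)
  rw [colouredNorm, colouredDensity_step hcm hdm hc hd, h0, mul_zero, norm_zero,
    Real.zero_rpow hpos]

theorem IsComplexNormingWith.homSum_add_le {α : H.EdgeColouring} (h : H.IsComplexNormingWith α)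
    {ι κ : Type*} [Fintype ι] [Fintype κ] (M N : ι → κ → ℂ) :
    ‖homSum Subtype.val α (M + N)‖ ^ (1 / (H.edges.card : ℝ)) ≤
      ‖homSum Subtype.val α M‖ ^ (1 / (H.edges.card : ℝ)) +
        ‖homSum Subtype.val α N‖ ^ (1 / (H.edges.card : ℝ)) := by
  by_cases hempty : IsEmpty ι ∨ IsEmpty κ
  · have hsub : ∀ M N : ι → κ → ℂ, M = N := by
      intro M N
      rcases hempty with _ | _ <;> exact Subsingleton.elim _ _
    rw [hsub (M + N) M]
    exact le_add_of_nonneg_right (by positivity)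
  rw [not_or, not_isEmpty_iff, not_isEmpty_iff] at hempty
  obtain ⟨_, _⟩ := hempty
  let : MeasurableSpace ι := ⊤
  let : MeasurableSpace κ := ⊤
  obtain ⟨c, hcm, hc⟩ := exists_uniform_labelling ι
  obtain ⟨d, hdm, hd⟩ := exists_uniform_labelling κ
  have h1 := h.add_le _ _ (isBoundedMeasurable_step hcm hdm M) (isBoundedMeasurable_step hcm hdm N)
  have h2 : (fun z : I × I => M (c z.1) (d z.2)) + (fun z => N (c z.1) (d z.2)) =
      fun z => (M + N) (c z.1) (d z.2) := rfl
  have hK : 0 < ‖((Fintype.card ι : ℂ) ^ Fintype.card A *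
      (Fintype.card κ : ℂ) ^ Fintype.card B)⁻¹‖ :=
    norm_pos_iff.2 (inv_ne_zero (mul_ne_zero (pow_ne_zero _ (by simp)) (pow_ne_zero _ (by simp))))
  simp only [h2, colouredNorm, colouredDensity_step hcm hdm hc hd, norm_mul _ (homSum _ _ _),
    Real.mul_rpow (norm_nonneg _) (norm_nonneg (homSum _ _ _)), ← mul_add] at h1
  exact le_of_mul_le_mul_left h1 (Real.rpow_pos_of_pos hK _)

end BipartiteGraph

/-! ### Comparison of colourings by the tensor power trick -/

theorem le_of_forall_pow_le_mul_pow {a b C : ℝ} (hb : 0 ≤ b)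
    (h : ∀ k : ℕ, a ^ k ≤ C * b ^ k) : a ≤ b := by
  by_contra! hlt
  rcases hb.eq_or_lt with rfl | hb
  · have := h 1
    simp at this
    linarith
  · obtain ⟨k, hk⟩ := pow_unbounded_of_one_lt C ((one_lt_div hb).2 hlt)
    rw [div_pow, lt_div_iff₀ (by positivity)] at hk
    exact absurd (h k) (not_le.2 hk)

namespace BipartiteGraph

variable {A B : Type*} [Fintype A] [Fintype B] {H : BipartiteGraph A B}

theorem IsComplexNormingWith.norm_homSum_le {β : H.EdgeColouring} (h : H.IsComplexNormingWith β)
    (γ : H.EdgeColouring) {ι κ : Type*} [Fintype ι] [Fintype κ] {M : ι → κ → ℂ} (hM : M ≠ 0) :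
    ‖homSum Subtype.val γ M‖ ≤ ‖homSum Subtype.val β M‖ := by
  classical
  have hn := h.card_ne_zero
  have hMex : ∃ i j, M i j ≠ 0 := by simpa [funext_iff] using hM
  have hT0 : tensor M (fun i j => conj (M i j)) ≠ 0 := by
    obtain ⟨i, j, hij⟩ := hMex
    intro h0
    have := congrFun (congrFun h0 (i, i)) (j, j)
    simp [tensor, hij] at this
  -- Passing to `M ⊗ conj M` makes every term a nonnegative real, so the sum over colourings has no
  -- cancellation.
  have hT : ∀ δ : H.EdgeColouring,
      homSum Subtype.val δ (tensor M (fun i j => conj (M i j))) =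
        ((‖homSum Subtype.val δ M‖ ^ 2 : ℝ) : ℂ) := by
    intro δ
    rw [homSum_tensor, homSum_conj, Complex.mul_conj']
    push_cast
    rfl
  refine le_of_sq_le_sq ?_ (norm_nonneg _)
  -- The factor `2` of the triangle inequality, raised to the power `e(H)`, does not depend on `k`
  -- and so disappears in the limit.
  refine le_of_forall_pow_le_mul_pow (C := 2 ^ H.edges.card) (by positivity) fun k => ?_
  obtain ⟨ι', κ', _, _, F, -, hF⟩ :=
    exists_homSum_eq_pow (A := A) (B := B) (ε := {e // e ∈ H.edges}) _ hT0 k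
  have hF' : ∀ δ : H.EdgeColouring, homSum Subtype.val δ F =
      (((‖homSum Subtype.val δ M‖ ^ 2) ^ k : ℝ) : ℂ) := by
    intro δ
    rw [hF, hT]
    push_cast
    rfl
  have hsum : ‖homSum Subtype.val β (F + fun i j => conj (F i j))‖ =
      ∑ δ : H.EdgeColouring, (‖homSum Subtype.val δ M‖ ^ 2) ^ k := by
    have h1 := homSum_add_conj Subtype.val β F
    simp only [hF', ← Complex.ofReal_sum] at h1
    rw [show (F + fun i j => conj (F i j)) = fun i j => F i j + conj (F i j) from rfl, h1,
      Complex.norm_real, Real.norm_of_nonneg (Finset.sum_nonneg fun _ _ => by positivity)]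
  have htri := h.homSum_add_le F (fun i j => conj (F i j))
  rw [homSum_conj, Complex.norm_conj, ← two_mul, hsum, hF' β, Complex.norm_real,
    Real.norm_of_nonneg (by positivity)] at htri
  have hpow := pow_le_pow_left₀ (by positivity) htri H.edges.card
  have hpow1 : ∀ x : ℝ, 0 ≤ x → (x ^ (1 / (H.edges.card : ℝ))) ^ H.edges.card = x := fun x hx => by
    rw [one_div, Real.rpow_inv_natCast_pow hx hn]
  rw [mul_pow, hpow1 _ (by positivity), hpow1 _ (by positivity)] at hpow
  exact (Finset.single_le_sum (f := fun δ : H.EdgeColouring => (‖homSum Subtype.val δ M‖ ^ 2) ^ k)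
    (fun _ _ => by positivity) (Finset.mem_univ γ)).trans hpow

theorem IsComplexNormingWith.homSum_eq_homSum {β γ : H.EdgeColouring}
    (hβ : H.IsComplexNormingWith β) (hγ : H.IsComplexNormingWith γ)
    {ι κ : Type*} [Fintype ι] [Fintype κ] (M : ι → κ → ℂ) (hM : M ≠ 0) :
    homSum Subtype.val β M = homSum Subtype.val γ M := by
  rw [homSum_eq_norm Subtype.val β (fun _ _ _ _ _ => hβ.homSum_ne_zero) M hM,
    homSum_eq_norm Subtype.val γ (fun _ _ _ _ _ => hγ.homSum_ne_zero) M hM,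
    le_antisymm (hγ.norm_homSum_le β hM) (hβ.norm_homSum_le γ hM)]

end BipartiteGraph

/-! ### Recovering the coloured graph from its sums -/

/-- A polynomial in `z` and `conj z` that vanishes at every complex `z` is the zero polynomial. -/
theorem MvPolynomial.eq_zero_of_eval_conj_eq_zero {X : Type*} (P : MvPolynomial (Fin 2 × X) ℂ)
    (h : ∀ z : X → ℂ, MvPolynomial.eval (fun i => twist i.1 (z i.2)) P = 0) : P = 0 := by
  let sgn (c : Fin 2) : ℂ := if c = 1 then 1 else -1
  -- `Q` is `P` in real and imaginary parts: `z = x₁ + i x₀`, `conj z = x₁ - i x₀`. It vanishes at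
  -- real points, hence identically, and this linear substitution is invertible.
  let Q : MvPolynomial (Fin 2 × X) ℂ :=
    MvPolynomial.bind₁ (fun i => MvPolynomial.X (1, i.2) +
      MvPolynomial.C (sgn i.1 * Complex.I) * MvPolynomial.X (0, i.2)) P
  have hQ : ∀ x, MvPolynomial.eval x Q =
      MvPolynomial.eval (fun i => x (1, i.2) + sgn i.1 * Complex.I * x (0, i.2)) P := by
    intro x
    simp only [Q, MvPolynomial.eval, MvPolynomial.eval₂Hom_bind₁]
    congr 2
    ext i
    simp
  have hQ0 : Q = 0 := by
    refine MvPolynomial.funext_set (fun _ => Set.range ((↑) : ℝ → ℂ))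
      (fun _ => Set.infinite_range_of_injective Complex.ofReal_injective) fun x hx => ?_
    rw [hQ, map_zero, ← h fun a => x (1, a) + Complex.I * x (0, a)]
    have hreal : ∀ i, conj (x i) = x i := fun i => by
      obtain ⟨r, hr⟩ := hx i (Set.mem_univ i)
      rw [← hr, Complex.conj_ofReal]
    congr 2
    ext ⟨c, a⟩
    fin_cases c <;> simp [sgn, hreal]
  refine MvPolynomial.funext fun y => ?_
  have h1 := hQ fun i =>
    if i.1 = 1 then (y (1, i.2) + y (0, i.2)) / 2 else (y (1, i.2) - y (0, i.2)) / (2 * Complex.I)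
  rw [hQ0, map_zero] at h1
  rw [map_zero, h1]
  congr 2
  ext ⟨c, a⟩
  have hI : Complex.I ≠ 0 := Complex.I_ne_zero
  fin_cases c
  · simp [sgn]
    field_simp
    ring
  · simp [sgn]
    field_simp
    ring

section Recover

variable {A B ε : Type*} [Fintype A] [Fintype B] [Fintype ε]

/-- With `z` and `conj z` as independent variables, each coefficient counts the maps having a given
monomial. The identity has its monomial under `c`, so some `(f, g)` has the same one under `d`, and
each variable of it comes from an edge. -/
theorem exists_map_of_homSum_eq (s : ε → A × B) (c d : ε → Fin 2)
    (h : ∀ M : A → B → ℂ, homSum s c M = homSum s d M) :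
    ∃ (f : A → A) (g : B → B), ∀ e, ∃ e', (f (s e').1, g (s e').2) = s e ∧ d e' = c e := by
  classical
  let expo (c : ε → Fin 2) (p : (A → A) × (B → B)) : (Fin 2 × A × B) →₀ ℕ :=
    ∑ e, Finsupp.single (c e, p.1 (s e).1, p.2 (s e).2) 1
  let P (c : ε → Fin 2) : MvPolynomial (Fin 2 × A × B) ℂ :=
    ∑ p : (A → A) × (B → B), MvPolynomial.monomial (expo c p) 1
  have hP : P c - P d = 0 := by
    refine MvPolynomial.eq_zero_of_eval_conj_eq_zero _ fun z => ?_
    have heval : ∀ c, MvPolynomial.eval (fun i => twist i.1 (z i.2)) (P c) =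
        homSum s c fun a b => z (a, b) := by
      intro c
      simp only [P, expo, homSum, homWeight, map_sum, MvPolynomial.monomial_sum_one, map_prod]
      simp [MvPolynomial.eval_monomial]
    rw [map_sub, heval, heval, h, sub_self]
  have hcoeff : ∀ c m, MvPolynomial.coeff m (P c) =
      (Finset.univ.filter fun p => expo c p = m).card := by
    intro c m
    simp [P, MvPolynomial.coeff_sum, MvPolynomial.coeff_monomial]
  have hpos : 0 < (Finset.univ.filter fun p => expo c p = expo c (id, id)).card :=
    Finset.card_pos.2 ⟨(id, id), by simp⟩
  have heq : (Finset.univ.filter fun p => expo c p = expo c (id, id)).card =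
      (Finset.univ.filter fun p => expo d p = expo c (id, id)).card := by
    have h1 := hcoeff c (expo c (id, id))
    rw [sub_eq_zero.1 hP, hcoeff] at h1
    exact_mod_cast h1.symm
  rw [heq] at hpos
  obtain ⟨⟨f, g⟩, hfg⟩ := Finset.card_pos.1 hpos
  simp only [Finset.mem_filter, Finset.mem_univ, true_and] at hfg
  refine ⟨f, g, fun e => ?_⟩
  by_contra! hno
  have h1 := DFunLike.congr_fun hfg (c e, s e)
  simp only [expo, Finsupp.coe_finsetSum, Finset.sum_apply, Finsupp.single_apply] at h1
  rw [Finset.sum_eq_zero fun e' _ => if_neg fun h2 => by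
    rw [Prod.mk.injEq] at h2
    exact hno e' h2.2 h2.1] at h1
  have h2 := (Finset.sum_eq_zero_iff.1 h1.symm) e (Finset.mem_univ e)
  simp at h2

/-- Needed because `f` and `g` are arbitrary on isolated vertices. On `V`, counting turns the
covering into injectivity. -/
theorem exists_perm_extending {X : Type*} [Finite X] (f : X → X) (V : Set X)
    (h : V ⊆ f '' V) : ∃ φ : Equiv.Perm X, ∀ x ∈ V, φ x = f x := by
  classical
  have := Fintype.ofFinite X
  have hinj : Set.InjOn f V := by
    refine Set.injOn_of_ncard_image_eq ?_ V.toFinite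
    exact le_antisymm (Set.ncard_image_le V.toFinite) (Set.ncard_le_ncard h (Set.toFinite _))
  obtain ⟨g, hg⟩ := Set.MapsTo.exists_equiv_extend_of_card_eq (t := (Finset.univ : Finset X))
    (by simp) (f := f) (s := V) (fun _ _ => by simp) hinj
  exact ⟨g.trans (Equiv.subtypeUnivEquiv Finset.mem_univ), fun x hx => hg x hx⟩

end Recover

namespace BipartiteGraph

theorem colouredIso_of_homSum_eq {A B : Type*} [Fintype A] [Fintype B] {H : BipartiteGraph A B}
    (β γ : H.EdgeColouring)
    (h : ∀ M : A → B → ℂ, homSum Subtype.val γ M = homSum Subtype.val β M) :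
    ColouredIso H β H γ := by
  obtain ⟨f, g, hfg⟩ := exists_map_of_homSum_eq _ _ _ h
  obtain ⟨φ, hφ⟩ := exists_perm_extending f {a | ∃ e ∈ H.edges, e.1 = a} (by
    rintro _ ⟨e, he, rfl⟩
    obtain ⟨e', h1, -⟩ := hfg ⟨e, he⟩
    exact ⟨_, ⟨e', e'.2, rfl⟩, congrArg Prod.fst h1⟩)
  obtain ⟨ψ, hψ⟩ := exists_perm_extending g {b | ∃ e ∈ H.edges, e.2 = b} (by
    rintro _ ⟨e, he, rfl⟩
    obtain ⟨e', h1, -⟩ := hfg ⟨e, he⟩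
    exact ⟨_, ⟨e', e'.2, rfl⟩, congrArg Prod.snd h1⟩)
  choose ρ hρ hcol using hfg
  have hρ' : ∀ e, (φ (ρ e).1.1, ψ (ρ e).1.2) = e.1 := fun e => by
    rw [hφ _ ⟨_, (ρ e).2, rfl⟩, hψ _ ⟨_, (ρ e).2, rfl⟩, hρ]
  -- The chosen preimage map on edges is injective, hence bijective by finiteness, so `(φ, ψ)` maps
  -- edges to edges in both directions.
  have hinj : Function.Injective ρ := fun e e' hee => Subtype.ext (by rw [← hρ' e, ← hρ' e', hee])
  have hsurj := Finite.surjective_of_injective hinj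
  have hedge : ∀ e : {e // e ∈ H.edges}, ∃ he : (φ e.1.1, ψ e.1.2) ∈ H.edges,
      β e = γ ⟨(φ e.1.1, ψ e.1.2), he⟩ := by
    intro e
    obtain ⟨e', rfl⟩ := hsurj e
    have he : (φ (ρ e').1.1, ψ (ρ e').1.2) ∈ H.edges := hρ' e' ▸ e'.2
    exact ⟨he, (hcol e').trans (congrArg γ (Subtype.ext (hρ' e').symm))⟩
  refine ⟨φ, ψ, fun u v => ⟨fun huv => (hedge ⟨(u, v), huv⟩).1, fun huv => ?_⟩,
    fun u v huv => (hedge ⟨(u, v), huv⟩).2⟩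
  have h1 := hρ' ⟨_, huv⟩
  simp only [Prod.mk.injEq, EmbeddingLike.apply_eq_iff_eq] at h1
  have h2 : (ρ ⟨_, huv⟩).1 = (u, v) := Prod.ext h1.1 h1.2
  exact h2 ▸ (ρ ⟨_, huv⟩).2

end BipartiteGraph

theorem theorem1p2 {A B : Type*} [Fintype A] [Fintype B] (H : BipartiteGraph A B)
    (hH : H.IsComplexNorming) :
    ∃ α : H.EdgeColouring, H.IsComplexNormingWith α ∧
      ∀ β γ : H.EdgeColouring, H.IsComplexNormingWith β → H.IsComplexNormingWith γ →
        BipartiteGraph.ColouredIso H β H γ := by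
  obtain ⟨α, hα⟩ := hH
  refine ⟨α, hα, fun β γ hβ hγ => BipartiteGraph.colouredIso_of_homSum_eq β γ fun M => ?_⟩
  -- The zero matrix is outside the positivity argument; its sums vanish because there is an edge.
  by_cases hM : M = 0
  · subst hM
    have : Nonempty {e // e ∈ H.edges} :=
      (Finset.card_pos.1 (Nat.pos_of_ne_zero hβ.card_ne_zero)).to_subtype
    have h0 : ∀ c : H.EdgeColouring, homSum Subtype.val c (0 : A → B → ℂ) = 0 := fun c => by
      simpa [homSum, homWeight] using hβ.card_ne_zero
    rw [h0, h0]
  · exact hγ.homSum_eq_homSum hβ M hM
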